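/- Powers are principal: $z^{\gamma}=e^{\gamma\ln z}$ on $\mathbb C\setminus\mathbb R_-$. Let ${}_2F_1(p,q;r;z)$ be the analytic continuation to the cut plane $\mathbb C\setminus[1,+\infty)$ of Gauss' hypergeometric series. Let $t>0$ and $\beta_1,\beta_2\in\mathbb R$ with $\beta_2>-1$, and put $$I_-(\beta_1,\beta_2;0,t)(a,b)=\int_0^t(-\mathrm i(u-a))^{\beta_1}(-\mathrm i(u-b))^{\beta_2}\,du .$$ For every fixed $b\in\mathbb C$ with $\operatorname{Im} b\le 0$, this integral converges for all $a$ with $\operatorname{Im} a<0$ and is an analytic function of $a$ on $\{\operatorname{Im} a<0\}$. Assume moreover that $\beta_1+\beta_2+1\notin\{0,1,2,\dots\}$, and fix $b$ with $0<\operatorname{Re} b<t$, $\operatorname{Im} b\le0$. For $s\in\{0,t\}$ put $$\Phi(\beta_1,\beta_2;s)(a,b)=(-\mathrm i(s-b))^{\beta_1+\beta_2+1}\,{}_2F_1\Bigl(-\beta_1,-\beta_1-\beta_2-1;-\beta_1-\beta_2;\tfrac{a-b}{s-b}\Bigr),$$ and let $S=\{a\in\mathbb C: 0<\operatorname{Re}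 a<t\}$. Then: (i) For $a\in S$ with $\operatorname{Im} a<\operatorname{Im} b$, $$I_-(\beta_1,\beta_2;0,t)(a,b)=\frac{\mathrm i}{\beta_1+\beta_2+1}\bigl[\Phi(\beta_1,\beta_2;t)(a,b)-\Phi(\beta_1,\beta_2;0)(a,b)\bigr].$$ The functions $a\mapsto\Phi(\beta_1,\beta_2;0)(a,b)$ and $a\mapsto\Phi(\beta_1,\beta_2;t)(a,b)$ are analytic on the whole strip $S$. Hence $a\mapsto I_-(\beta_1,\beta_2;0,t)(a,b)$ extends analytically from $S\cap\{\operatorname{Im}a<0\}$ to $S$; in particular the extension has no singularity at $a=b$. In (ii)--(v), $1/\Gamma$ is taken to be $0$ at the poles of $\Gamma$. (ii) If $\beta_1\notin\{-1,-2,\dots\}$, then for $a\in S$ with $|a/b|<1$, $$\Phi(\beta_1,\beta_2;0)(a,b)=(\mathrm i b)^{\beta_1+\beta_2+1}\Bigl\{\tfrac{\Gamma(-\beta_1-\beta_2)\Gamma(1+\beta_1)}{\Gamma(-\beta_2)}\bigl(1-\tfrac ab\bigr)^{\beta_1+\beta_2+1}+\tfrac{\beta_1+\beta_2+1}{\beta_1+1}\bigl(\tfrac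 ab\bigr)^{1+\beta_1}{}_2F_1\bigl(-\beta_2,1;\beta_1+2;\tfrac ab\bigr)\Bigr\}.$$ (iii) For $a\in S$ with $|a/b|>1$, $$\Phi(\beta_1,\beta_2;0)(a,b)=(\mathrm i b)^{\beta_1+\beta_2+1}\Bigl\{\tfrac{\Gamma(-\beta_1-\beta_2)\Gamma(1+\beta_2)}{\Gamma(-\beta_1)}\bigl(\tfrac ba\bigr)^{-\beta_1-\beta_2-1}\bigl(1-\tfrac ba\bigr)^{\beta_1+\beta_2+1}+\tfrac{\beta_1+\beta_2+1}{\beta_2+1}\bigl(\tfrac ba\bigr)^{-\beta_1}{}_2F_1\bigl(-\beta_1,1;\beta_2+2;\tfrac ba\bigr)\Bigr\}.$$ (iv) If $\beta_1\notin\{-1,-2,\dots\}$, then for $a\in S$ with $\bigl|\tfrac{t-a}{t-b}\bigr|<1$, $$\Phi(\beta_1,\beta_2;t)(a,b)=(-\mathrm i(t-b))^{\beta_1+\beta_2+1}\Bigl\{\tfrac{\Gamma(-\beta_1-\beta_2)\Gamma(1+\beta_1)}{\Gamma(-\beta_2)}\bigl(\tfrac{a-b}{t-b}\bigr)^{\beta_1+\beta_2+1}+\tfrac{\beta_1+\beta_2+1}{\beta_1+1}\bigl(\tfrac{t-a}{t-b}\bigr)^{1+\beta_1}{}_2F_1\bigl(-\beta_2,1;\beta_1+2;\tfrac{t-a}{t-b}\bigr)\Bigr\}.$$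 (v) For $a\in S$ with $\bigl|\tfrac{t-a}{t-b}\bigr|>1$, $$\Phi(\beta_1,\beta_2;t)(a,b)=(-\mathrm i(t-b))^{\beta_1+\beta_2+1}\Bigl\{\tfrac{\Gamma(-\beta_1-\beta_2)\Gamma(1+\beta_2)}{\Gamma(-\beta_1)}\bigl(\tfrac{t-b}{t-a}\bigr)^{-\beta_1-\beta_2-1}\bigl(\tfrac{b-a}{t-a}\bigr)^{\beta_1+\beta_2+1}+\tfrac{\beta_1+\beta_2+1}{\beta_2+1}\bigl(\tfrac{t-b}{t-a}\bigr)^{-\beta_1}{}_2F_1\bigl(-\beta_1,1;\beta_2+2;\tfrac{t-b}{t-a}\bigr)\Bigr\}.$$ -/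

import Mathlib

/-- The cut plane `ℂ ∖ [1, +∞)`. -/
def cutPlane : Set ℂ := {z : ℂ | z.re < 1 ∨ z.im ≠ 0}

/-- `f` is the analytic continuation to the cut plane `ℂ ∖ [1, +∞)` of the sum of the
hypergeometric series, which converges in the open unit disc. -/
def IsGaussContinuation (a b c : ℂ) (f : ℂ → ℂ) : Prop :=
  AnalyticOnNhd ℂ f cutPlane ∧ Set.EqOn f (₂F₁ a b c) (Metric.ball (0 : ℂ) 1)

open Classical in
/-- Gauss' hypergeometric function on the cut plane `ℂ ∖ [1, +∞)`: the analytic continuation of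
the hypergeometric series. The default value in the `else` branch is the series itself, so that
in the unit disc the function is the series without any further argument. -/
noncomputable def gaussHyp (a b c : ℂ) : ℂ → ℂ :=
  if h : ∃ f : ℂ → ℂ, IsGaussContinuation a b c f then Classical.choose h else ₂F₁ a b c

/-- In the unit disc `gaussHyp` is the sum of the hypergeometric series. -/
theorem gaussHyp_eqOn_ball (a b c : ℂ) :
    Set.EqOn (gaussHyp a b c) (₂F₁ a b c) (Metric.ball (0 : ℂ) 1) := by
  unfold gaussHyp
  split_ifs with h
  · exact (Classical.choose_spec h).2
  · exact fun _ _ => rfl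

theorem isPreconnected_cutPlane : IsPreconnected cutPlane := by
  have hstar : StarConvex ℝ (0 : ℂ) cutPlane := by
    rw [starConvex_zero_iff]
    intro z hz r hr0 hr1
    rcases hz with hz | hz
    · left
      have : (r • z).re = r * z.re := by simp
      rw [this]
      rcases hr0.eq_or_lt with h | h
      · simp [← h]
      · nlinarith
    · rcases hr0.eq_or_lt with h | h
      · left; simp [← h]
      · right
        have : (r • z).im = r * z.im := by simp
        rw [this]
        exact mul_ne_zero h.ne' hz
  exact (hstar.isPathConnected (show (0 : ℂ).re < 1 ∨ (0 : ℂ).im ≠ 0 by simp)).isConnected.isPreconnected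

/-- The continuation is unique, and `gaussHyp` is equal to it. -/
theorem IsGaussContinuation.eqOn {a b c : ℂ} {f : ℂ → ℂ} (hf : IsGaussContinuation a b c f) :
    Set.EqOn (gaussHyp a b c) f cutPlane := by
  have h : ∃ f : ℂ → ℂ, IsGaussContinuation a b c f := ⟨f, hf⟩
  have hg : IsGaussContinuation a b c (gaussHyp a b c) := by
    unfold gaussHyp
    rw [dif_pos h]
    exact Classical.choose_spec h
  refine hg.1.eqOn_of_preconnected_of_eventuallyEq hf.1 isPreconnected_cutPlane
    (z₀ := 0) (by simp [cutPlane]) ?_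
  filter_upwards [Metric.ball_mem_nhds (0 : ℂ) one_pos] with z hz
  rw [hg.2 hz, hf.2 hz]

/-- The open vertical strip `0 < Re a < t`. -/
def strip (t : ℝ) : Set ℂ := {a : ℂ | 0 < a.re ∧ a.re < t}

/-- The integrand `(-i(u-a))^{β₁} (-i(u-b))^{β₂}`, with principal determinations. -/
noncomputable def integrandMinus (β₁ β₂ : ℝ) (a b : ℂ) (u : ℝ) : ℂ :=
  (-Complex.I * ((u : ℂ) - a)) ^ (β₁ : ℂ) * (-Complex.I * ((u : ℂ) - b)) ^ (β₂ : ℂ)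

/-- `I_-(β₁, β₂; 0, t)(a, b)`. -/
noncomputable def integralMinus (β₁ β₂ t : ℝ) (a b : ℂ) : ℂ :=
  ∫ u in (0 : ℝ)..t, integrandMinus β₁ β₂ a b u

/-- `Φ(β₁, β₂; s)(a, b)`. -/
noncomputable def Phi (β₁ β₂ s : ℝ) (a b : ℂ) : ℂ :=
  (-Complex.I * ((s : ℂ) - b)) ^ ((β₁ : ℂ) + β₂ + 1) *
    gaussHyp (-β₁) (-β₁ - β₂ - 1) (-β₁ - β₂) ((a - b) / ((s : ℂ) - b))

/-!
With `σ = β₁ + β₂ + 1` and `q = -σ`, the hypergeometric function in `Φ` is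
`F = ₂F₁(-β₁, q; q + 1; ·)`. Since `(q)ₙ / (q + 1)ₙ = q / (q + n)`, the series satisfies
`z F' + q F = q (1 - z) ^ β₁`: that is, `z ^ q F / q` is an incomplete beta function.
Everything follows from this first-order equation.

* Continuation. For `0 < Re q` the Euler integral solves the equation on the cut plane, a contiguity
  relation reaches the other values of `q` (`exists_solvesBetaEquation`), and a solution that is
  analytic at `0` is unique (`eventuallyEq_of_betaEquation`). So `gaussHyp (-β₁) q (q + 1)` is a
  genuine continuation and solves the equation on the whole cut plane
  (`solvesBetaEquation_reducedBeta`).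
* Transformations. The same uniqueness gives the Pfaff transformation (`reducedBeta_pfaff`), which
  exchanges `β₁` and `β₂` because `q + β₁ + β₂ + 1 = 0`, and the Euler transformation
  (`reducedBeta_eq_mul_series`).
* Connection between `0` and `1`. Let `G_{q, β}` be the solution of `z G' + q G = (1 - z) ^ β`
  that is analytic at `0`. Then
  `z ^ q G_{q, A - 1}(z)` and `-(1 - z) ^ A G_{A, q - 1}(1 - z)` are primitives of the same
  function `z ^ (q - 1) (1 - z) ^ (A - 1)`, so they differ by a constant. For positive real parts
  it is the beta integral; contiguity relations in `A` and in `q` give `Γ(q) Γ(A) / Γ(q + A)` in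
  general (`betaConnection_eq`). Together with the Euler transformation this is the expansion for
  `|w| < 1`, `w = 1 - z`, and the Pfaff transformation reduces `|w| > 1` to it.
* The integral. For `Im a, Im b < 0` the equation says exactly that `u ↦ Φ(u)(a, b)` is a primitive
  of `-i σ` times the integrand (`hasDerivAt_Phi`). The case of real `b`, where the integrand has a
  singularity in `(0, t)`, follows by dominated convergence from `b - i ε` (`integralMinus_eq`). The
  formula holds for all `a` in the strip with `Im a < 0`, and its right-hand side is analytic on the
  whole strip, because `1 - (a - b) / (s - b) = (s - a) / (s - b)` avoids `(-∞, 0]` there.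
-/

/-! ### The cut plane and integrals depending on a parameter -/

theorem mem_cutPlane_iff {z : ℂ} : z ∈ cutPlane ↔ 1 - z ∈ Complex.slitPlane := by
  simp [cutPlane, Complex.mem_slitPlane_iff]

theorem isOpen_cutPlane : IsOpen cutPlane := by
  have : cutPlane = (fun z : ℂ => 1 - z) ⁻¹' Complex.slitPlane := by
    ext z; exact mem_cutPlane_iff
  rw [this]
  exact Complex.isOpen_slitPlane.preimage (by fun_prop)

theorem zero_mem_cutPlane : (0 : ℂ) ∈ cutPlane := by simp [cutPlane]

theorem ball_subset_cutPlane : Metric.ball (0 : ℂ) 1 ⊆ cutPlane := by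
  intro z hz
  rw [mem_ball_zero_iff] at hz
  exact Or.inl ((Complex.re_le_norm z).trans_lt hz)

theorem inv_mem_slitPlane {z : ℂ} (hz : z ∈ Complex.slitPlane) : z⁻¹ ∈ Complex.slitPlane := by
  have hn : 0 < Complex.normSq z := Complex.normSq_pos.2 (Complex.slitPlane_ne_zero hz)
  rw [Complex.mem_slitPlane_iff] at hz ⊢
  rw [Complex.inv_re, Complex.inv_im]
  rcases hz with h | h
  · exact Or.inl (div_pos h hn)
  · exact Or.inr (div_ne_zero (neg_ne_zero.2 h) hn.ne')

/-- Differentiation under the integral sign for a kernel that is jointly continuous together with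
its complex derivative, integrated against an integrable weight. -/
theorem hasDerivAt_intervalIntegral_mul {U : Set ℂ} (hU : IsOpen U) {k k' : ℂ → ℝ → ℂ}
    {g : ℝ → ℂ} {t : ℝ} (ht : 0 ≤ t) (hg : IntervalIntegrable g MeasureTheory.volume 0 t)
    (hk : ContinuousOn (Function.uncurry k) (U ×ˢ Set.Icc 0 t))
    (hk' : ContinuousOn (Function.uncurry k') (U ×ˢ Set.Icc 0 t))
    (hd : ∀ z ∈ U, ∀ u ∈ Set.Icc 0 t, HasDerivAt (fun z => k z u) (k' z u) z)
    {z : ℂ} (hz : z ∈ U) :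
    IntervalIntegrable (fun u => k z u * g u) MeasureTheory.volume 0 t ∧
      IntervalIntegrable (fun u => k' z u * g u) MeasureTheory.volume 0 t ∧
      HasDerivAt (fun z => ∫ u in (0 : ℝ)..t, k z u * g u) (∫ u in (0 : ℝ)..t, k' z u * g u) z := by
  have slice : ∀ {h : ℂ → ℝ → ℂ}, ContinuousOn (Function.uncurry h) (U ×ˢ Set.Icc 0 t) →
      ∀ w ∈ U, IntervalIntegrable (fun u => h w u * g u) MeasureTheory.volume 0 t := by
    intro h hh w hw
    refine hg.continuousOn_mul ?_
    rw [Set.uIcc_of_le ht]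
    exact hh.comp (f := fun u => (w, u)) (by fun_prop) fun u hu => ⟨hw, hu⟩
  obtain ⟨r, hr, hrU⟩ := Metric.nhds_basis_closedBall.mem_iff.1 (hU.mem_nhds hz)
  obtain ⟨C, hC⟩ := ((isCompact_closedBall z r).prod (isCompact_Icc (a := (0 : ℝ)) (b := t)))
    |>.exists_bound_of_continuousOn (hk'.mono (Set.prod_mono hrU subset_rfl))
  have hIoc : ∀ u ∈ Set.uIoc 0 t, u ∈ Set.Icc 0 t := by
    intro u hu
    rw [Set.uIoc_of_le ht] at hu
    exact ⟨hu.1.le, hu.2⟩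
  have key := intervalIntegral.hasDerivAt_integral_of_dominated_loc_of_deriv_le
    (μ := MeasureTheory.volume) (a := 0) (b := t) (F := fun z u => k z u * g u)
    (F' := fun z u => k' z u * g u) (bound := fun u => C * ‖g u‖)
    (Metric.closedBall_mem_nhds z hr)
    (by
      filter_upwards [hU.mem_nhds hz] with w hw
      exact (slice hk w hw).def'.aestronglyMeasurable)
    (slice hk z hz) (slice hk' z hz).def'.aestronglyMeasurable
    (by
      refine Filter.Eventually.of_forall fun u hu w hw => ?_
      rw [norm_mul]
      gcongr
      exact hC (w, u) ⟨hw, hIoc u hu⟩)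
    (hg.norm.const_mul C)
    (by
      refine Filter.Eventually.of_forall fun u hu w hw => ?_
      exact (hd w (hrU hw) u (hIoc u hu)).mul_const (g u))
  exact ⟨slice hk z hz, key⟩

/-! ### The inhomogeneous equation of the incomplete beta function -/

/-- `f` is holomorphic on `ℂ ∖ [1, +∞)` and solves `z f' + q f = (1 - z) ^ β` there. For
`0 < Re q` such an `f` is `z ↦ ∫ s in 0..1, s ^ (q - 1) * (1 - z * s) ^ β`, that is,
`z ^ (-q)` times the incomplete beta function. -/
def SolvesBetaEquation (q β : ℂ) (f : ℂ → ℂ) : Prop :=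
  ∀ z ∈ cutPlane, ∃ f' : ℂ, HasDerivAt f f' z ∧ z * f' + q * f z = (1 - z) ^ β

theorem SolvesBetaEquation.analyticOnNhd {q β : ℂ} {f : ℂ → ℂ} (hf : SolvesBetaEquation q β f) :
    AnalyticOnNhd ℂ f cutPlane := by
  refine DifferentiableOn.analyticOnNhd (fun z hz => ?_) isOpen_cutPlane
  obtain ⟨f', h, -⟩ := hf z hz
  exact h.differentiableAt.differentiableWithinAt

theorem hasDerivAt_one_sub_cpow {z : ℂ} (hz : 1 - z ∈ Complex.slitPlane) (β : ℂ) :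
    HasDerivAt (fun z : ℂ => (1 - z) ^ β) (-β * (1 - z) ^ (β - 1)) z := by
  have := ((hasDerivAt_id z).const_sub 1).cpow_const (c := β) hz
  simpa using this

theorem cpow_eq_mul_cpow_sub_one {x : ℂ} (hx : x ≠ 0) (β : ℂ) : x ^ β = x * x ^ (β - 1) := by
  rw [Complex.cpow_sub _ _ hx, Complex.cpow_one]
  field_simp

/-- The Euler integral solves the equation. -/
theorem solvesBetaEquation_integral {q : ℂ} (hq : 0 < q.re) (β : ℂ) :
    SolvesBetaEquation q β
      (fun z => ∫ s in (0 : ℝ)..1, (1 - z * s) ^ β * (s : ℂ) ^ (q - 1)) := by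
  have hslit : ∀ z ∈ cutPlane, ∀ s ∈ Set.Icc (0 : ℝ) 1, 1 - z * s ∈ Complex.slitPlane := by
    intro z hz s hs
    have h := (Complex.starConvex_one_slitPlane.add_smul_mem
      (y := -z) (by simpa [← sub_eq_add_neg] using mem_cutPlane_iff.1 hz) hs.1 hs.2)
    convert h using 1
    simp [mul_comm]; ring
  have hcont : ∀ γ : ℂ, ContinuousOn (fun p : ℂ × ℝ => (1 - p.1 * p.2) ^ γ)
      (cutPlane ×ˢ Set.Icc (0 : ℝ) 1) := by
    intro γ
    refine ContinuousOn.cpow_const (by fun_prop) ?_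
    rintro ⟨z, s⟩ ⟨hz, hs⟩
    exact hslit z hz s hs
  intro z hz
  have hint : IntervalIntegrable (fun s : ℝ => (s : ℂ) ^ (q - 1)) MeasureTheory.volume 0 1 :=
    intervalIntegral.intervalIntegrable_cpow' (by simpa using hq)
  obtain ⟨h1, h2, h3⟩ := hasDerivAt_intervalIntegral_mul (U := cutPlane) isOpen_cutPlane
    (k := fun z s => (1 - z * s) ^ β) (k' := fun z s => -(β * s) * (1 - z * s) ^ (β - 1))
    zero_le_one hint (hcont β)
    (by
      refine ContinuousOn.mul (by fun_prop) (hcont (β - 1)))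
    (by
      intro z hz s hs
      have := (((hasDerivAt_id z).mul_const (s : ℂ)).const_sub 1).cpow_const (c := β)
        (hslit z hz s hs)
      refine this.congr_deriv ?_
      simp only [id_eq]
      ring) hz
  refine ⟨_, h3, ?_⟩
  rw [← intervalIntegral.integral_const_mul, ← intervalIntegral.integral_const_mul,
    ← intervalIntegral.integral_add (h2.const_mul z) (h1.const_mul q)]
  have hq0 : q ≠ 0 := by rintro rfl; simp at hq
  -- the integrand is the derivative of `s ^ q * (1 - z * s) ^ β`
  rw [intervalIntegral.integral_eq_sub_of_hasDeriv_right_of_le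
    (f := fun s : ℝ => (s : ℂ) ^ q * (1 - z * s) ^ β) zero_le_one]
  · simp [Complex.zero_cpow hq0]
  · refine ContinuousOn.mul ?_ ?_
    · exact (Complex.continuous_ofReal_cpow_const hq).continuousOn
    · exact (hcont β).comp (f := fun s : ℝ => (z, s)) (by fun_prop) fun s hs => ⟨hz, hs⟩
  · intro s hs
    have hs0 : (s : ℂ) ≠ 0 := by exact_mod_cast hs.1.ne'
    have hsl := hslit z hz s ⟨hs.1.le, hs.2.le⟩
    have d1 : HasDerivAt (fun s : ℂ => s ^ q) (q * (s : ℂ) ^ (q - 1)) s := by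
      simpa using (hasDerivAt_id (s : ℂ)).cpow_const (c := q) (by simp [hs.1])
    have d2 : HasDerivAt (fun s : ℂ => (1 - z * s) ^ β) (β * (1 - z * s) ^ (β - 1) * (-z)) s := by
      simpa using (((hasDerivAt_id (s : ℂ)).const_mul z).const_sub 1).cpow_const (c := β) hsl
    refine ((d1.mul d2).comp_ofReal.congr_deriv ?_).hasDerivWithinAt
    rw [cpow_eq_mul_cpow_sub_one hs0 q]
    ring
  · exact (h2.const_mul z).add (h1.const_mul q)

/-- The contiguity relation that lowers `q` and keeps `β`. -/
theorem SolvesBetaEquation.lower {q β : ℂ} {f : ℂ → ℂ} (hq : q ≠ 0)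
    (hf : SolvesBetaEquation (q + 1) β f) :
    SolvesBetaEquation q β (fun z => ((1 - z) ^ (β + 1) + (q + β + 1) * (z * f z)) / q) := by
  intro z hz
  obtain ⟨f', hd, he⟩ := hf z hz
  have hsl := mem_cutPlane_iff.1 hz
  have d1 := hasDerivAt_one_sub_cpow hsl (β + 1)
  have d2 := (d1.add (((hasDerivAt_id z).mul hd).const_mul (q + β + 1))).div_const q
  refine ⟨_, d2, ?_⟩
  have h1 := cpow_eq_mul_cpow_sub_one (Complex.slitPlane_ne_zero hsl) (β + 1)
  simp only [add_sub_cancel_right, id] at h1 ⊢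
  rw [h1]
  field_simp
  linear_combination (q + β + 1) * z * he

/-- The contiguity relation that lowers `β` and keeps `q`. -/
theorem SolvesBetaEquation.lower_exponent {q A : ℂ} {f : ℂ → ℂ} (hA : A ≠ 0)
    (hf : SolvesBetaEquation q A f) :
    SolvesBetaEquation q (A - 1) (fun z => ((q + A) * f z - (1 - z) ^ A) / A) := by
  intro z hz
  obtain ⟨f', hd, he⟩ := hf z hz
  have hsl := mem_cutPlane_iff.1 hz
  have d2 := ((hd.const_mul (q + A)).sub (hasDerivAt_one_sub_cpow hsl A)).div_const A
  refine ⟨_, d2, ?_⟩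
  have h1 := cpow_eq_mul_cpow_sub_one (Complex.slitPlane_ne_zero hsl) A
  beta_reduce
  rw [h1] at he ⊢
  field_simp
  linear_combination (q + A) * he

theorem exists_solvesBetaEquation {q : ℂ} (hq : ∀ n : ℕ, q ≠ -n) (β : ℂ) :
    ∃ f, SolvesBetaEquation q β f := by
  obtain ⟨N, hN⟩ := exists_nat_gt (-q.re)
  induction N generalizing q with
  | zero => exact ⟨_, solvesBetaEquation_integral (by simpa using hN) β⟩
  | succ N ih =>
    obtain ⟨f, hf⟩ := ih (q := q + 1) (fun n h => hq (n + 1) (by push_cast; linear_combination h))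
      (by push_cast at hN; simp; linarith)
    exact ⟨_, hf.lower (by simpa using hq 0)⟩

/-- A function analytic at `0` that solves the homogeneous equation vanishes near `0`: its lowest
Taylor coefficient, of order `n` say, would be annihilated by `q + n`. -/
theorem eventually_eq_zero_of_homogeneous {q : ℂ} (hq : ∀ n : ℕ, q ≠ -n) {h : ℂ → ℂ}
    (ha : AnalyticAt ℂ h 0) (he : ∀ᶠ z in nhds 0, z * deriv h z + q * h z = 0) :
    ∀ᶠ z in nhds (0 : ℂ), h z = 0 := by
  by_contra hne
  obtain ⟨n, g, hg, hg0, hgh⟩ := ha.exists_eventuallyEq_pow_smul_nonzero_iff.2 hne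
  simp only [sub_zero, smul_eq_mul] at hgh
  have h1 : ∀ᶠ z in nhds (0 : ℂ), z ≠ 0 → z * deriv g z + (q + n) * g z = 0 := by
    filter_upwards [he, hgh.eventually_nhds, hg.eventually_analyticAt] with z hz hz' hgz hz0
    have hd : deriv h z = n * z ^ (n - 1) * g z + z ^ n * deriv g z := by
      rw [Filter.EventuallyEq.deriv_eq (f := fun z => z ^ n * g z) hz']
      exact ((hasDerivAt_pow n z).mul hgz.differentiableAt.hasDerivAt).deriv
    have hpow : (n : ℂ) * (z * z ^ (n - 1)) = n * z ^ n := by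
      rcases n with _ | n
      · simp
      · rw [Nat.add_sub_cancel, ← pow_succ']
    have h2 : z ^ n * (z * deriv g z + (q + n) * g z) = 0 := by
      rw [hd, hz'.self_of_nhds] at hz
      linear_combination hz - g z * hpow
    exact (mul_eq_zero.1 h2).resolve_left (pow_ne_zero n hz0)
  have h2 : Filter.Tendsto (fun z => z * deriv g z + (q + n) * g z) (nhdsWithin 0 {0}ᶜ)
      (nhds (0 * deriv g 0 + (q + n) * g 0)) :=
    ((continuousAt_id.mul hg.deriv.continuousAt).add
      (continuousAt_const.mul hg.continuousAt)).tendsto.mono_left nhdsWithin_le_nhds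
  have h3 : (0 : ℂ) = 0 * deriv g 0 + (q + n) * g 0 := by
    refine tendsto_nhds_unique ((tendsto_const_nhds (x := (0 : ℂ))).congr' ?_) h2
    filter_upwards [self_mem_nhdsWithin, nhdsWithin_le_nhds h1] with z hz hz'
    exact (hz' hz).symm
  rw [zero_mul, zero_add, eq_comm, mul_eq_zero, or_iff_left hg0] at h3
  exact hq n (eq_neg_of_add_eq_zero_left h3)

/-- Two functions analytic at `0` agree near `0` when they solve the equation with the same
right-hand side, whatever it is. -/
theorem eventuallyEq_of_betaEquation {q : ℂ} (hq : ∀ n : ℕ, q ≠ -n) {f g : ℂ → ℂ}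
    (hf : AnalyticAt ℂ f 0) (hg : AnalyticAt ℂ g 0)
    (he : ∀ᶠ z in nhds 0, z * deriv f z + q * f z = z * deriv g z + q * g z) :
    f =ᶠ[nhds 0] g := by
  have := eventually_eq_zero_of_homogeneous hq (hf.sub hg) (by
    filter_upwards [he, hf.eventually_analyticAt, hg.eventually_analyticAt] with z hz h1 h2
    rw [deriv_sub h1.differentiableAt h2.differentiableAt, Pi.sub_apply]
    linear_combination hz)
  filter_upwards [this] with z hz
  exact sub_eq_zero.1 hz

/-- Uniqueness on the cut plane. -/
theorem SolvesBetaEquation.eqOn {q β : ℂ} (hq : ∀ n : ℕ, q ≠ -n) {f g : ℂ → ℂ}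
    (hf : SolvesBetaEquation q β f) (hg : SolvesBetaEquation q β g) :
    Set.EqOn f g cutPlane := by
  refine hf.analyticOnNhd.eqOn_of_preconnected_of_eventuallyEq hg.analyticOnNhd
    isPreconnected_cutPlane zero_mem_cutPlane ?_
  refine eventuallyEq_of_betaEquation hq (hf.analyticOnNhd 0 zero_mem_cutPlane)
    (hg.analyticOnNhd 0 zero_mem_cutPlane) ?_
  filter_upwards [isOpen_cutPlane.mem_nhds zero_mem_cutPlane] with z hz
  obtain ⟨f', h1, h2⟩ := hf z hz
  obtain ⟨g', h3, h4⟩ := hg z hz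
  rw [h1.deriv, h3.deriv, h2, h4]

/-! ### The hypergeometric series -/

theorem one_le_radius_ordinaryHypergeometricSeries (a b c : ℂ) :
    1 ≤ (ordinaryHypergeometricSeries ℂ a b c).radius := by
  by_cases habc : ∀ k : ℕ, (k : ℂ) ≠ -a ∧ (k : ℂ) ≠ -b ∧ (k : ℂ) ≠ -c
  · exact (ordinaryHypergeometricSeries_radius_eq_one ℂ a b c habc).ge
  · push Not at habc
    obtain ⟨k, hk⟩ := habc
    have : (ordinaryHypergeometricSeries ℂ a b c).radius = ⊤ := by
      by_cases ha : (k : ℂ) = -a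
      · rw [← neg_eq_iff_eq_neg.2 ha]
        exact ordinaryHypergeometric_radius_top_of_neg_nat₁ ℂ b c
      by_cases hb : (k : ℂ) = -b
      · rw [← neg_eq_iff_eq_neg.2 hb]
        exact ordinaryHypergeometric_radius_top_of_neg_nat₂ ℂ a c
      · rw [← neg_eq_iff_eq_neg.2 (hk ha hb)]
        exact ordinaryHypergeometric_radius_top_of_neg_nat₃ ℂ a b
    simp [this]

theorem hasFPowerSeriesOnBall_ordinaryHypergeometric (a b c : ℂ) :
    HasFPowerSeriesOnBall (₂F₁ a b c : ℂ → ℂ) (ordinaryHypergeometricSeries ℂ a b c) 0 1 :=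
  ((ordinaryHypergeometricSeries ℂ a b c).hasFPowerSeriesOnBall
    (one_pos.trans_le (one_le_radius_ordinaryHypergeometricSeries a b c))).mono one_pos
    (one_le_radius_ordinaryHypergeometricSeries a b c)

theorem analyticOnNhd_ordinaryHypergeometric (a b c : ℂ) :
    AnalyticOnNhd ℂ (₂F₁ a b c : ℂ → ℂ) (Metric.ball 0 1) := by
  have := (hasFPowerSeriesOnBall_ordinaryHypergeometric a b c).analyticOnNhd
  rwa [← ENNReal.ofReal_one, Metric.eball_ofReal] at this

theorem hasSum_ordinaryHypergeometric (a b c : ℂ) {z : ℂ} (hz : ‖z‖ < 1) :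
    HasSum (fun n => ordinaryHypergeometricCoefficient a b c n * z ^ n) (₂F₁ a b c z) := by
  have := (hasFPowerSeriesOnBall_ordinaryHypergeometric a b c).hasSum (y := z)
    (by rw [← ENNReal.ofReal_one, Metric.eball_ofReal]; simpa using hz)
  simpa only [zero_add, ordinaryHypergeometricSeries_apply_eq, smul_eq_mul] using this

/-- The Euler operator `z d/dz` multiplies the `n`-th term of the series by `n`. -/
theorem hasSum_mul_deriv_ordinaryHypergeometric (a b c : ℂ) {z : ℂ} (hz : ‖z‖ < 1) :
    HasSum (fun n : ℕ => n * (ordinaryHypergeometricCoefficient a b c n * z ^ n))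
      (z * deriv (₂F₁ a b c) z) := by
  have h := (hasFPowerSeriesOnBall_ordinaryHypergeometric a b c).fderiv.hasSum (y := z)
    (by rw [← ENNReal.ofReal_one, Metric.eball_ofReal]; simpa using hz)
  have h' := (ContinuousLinearMap.apply ℂ ℂ z).hasSum h
  rw [← hasSum_nat_add_iff' 1]
  simp only [ContinuousLinearMap.apply_apply, zero_add,
    FormalMultilinearSeries.derivSeries_apply_diag, ordinaryHypergeometricSeries_apply_eq] at h'
  convert h' using 1
  · funext n
    simp [ordinaryHypergeometricCoefficient]
  · have hfd : fderiv ℂ (₂F₁ a b c : ℂ → ℂ) z z = z * deriv (₂F₁ a b c) z := by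
      rw [← fderiv_apply_one_eq_deriv, ← smul_eq_mul, ← map_smul]
      simp
    rw [hfd]
    simp

/-- The value of `z d/dz + q` on the series, written as a sum. -/
theorem hasSum_euler_ordinaryHypergeometric (q a b c : ℂ) {z : ℂ} (hz : ‖z‖ < 1) :
    HasSum (fun n : ℕ => (n + q) * ordinaryHypergeometricCoefficient a b c n * z ^ n)
      (z * deriv (₂F₁ a b c) z + q * ₂F₁ a b c z) := by
  convert (hasSum_mul_deriv_ordinaryHypergeometric a b c hz).add
    ((hasSum_ordinaryHypergeometric a b c hz).mul_left q) using 1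
  funext n
  ring

/-- The binomial series `₂F₁(-β, 1; 1; z) = (1 - z) ^ β`. -/
theorem ordinaryHypergeometric_one_one {z : ℂ} (hz : ‖z‖ < 1) (β : ℂ) :
    ₂F₁ (-β) 1 1 z = (1 - z) ^ β := by
  have hz' : -z ∈ Metric.eball (0 : ℂ) 1 := by
    rw [← ENNReal.ofReal_one, Metric.eball_ofReal]; simpa using hz
  have h := (Complex.one_add_cpow_hasFPowerSeriesOnBall_zero (a := β)).hasSum hz'
  rw [binomialSeries_eq_ordinaryHypergeometricSeries (b := (1 : ℂ))
    (fun k hk => by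
      have := congrArg Complex.re hk
      simp at this
      have hk0 : (0 : ℝ) ≤ k := k.cast_nonneg
      linarith)] at h
  rw [zero_add, ← sub_eq_add_neg] at h
  refine (hasSum_ordinaryHypergeometric (-β) 1 1 hz).unique
    ((congrArg (fun f => HasSum f _) (funext fun n => ?_)).mpr h)
  have harg : (⇑(-ContinuousLinearMap.id ℂ ℂ) ∘ fun _ : Fin n => -z) = fun _ => z := by
    funext i; simp
  rw [FormalMultilinearSeries.compContinuousLinearMap_apply, harg,
    ordinaryHypergeometricSeries_apply_eq, smul_eq_mul]

theorem ascPochhammer_eval_ne_zero {q : ℂ} (hq : ∀ n : ℕ, q ≠ -n) (n : ℕ) :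
    (ascPochhammer ℂ n).eval q ≠ 0 := by
  rw [Ne, ascPochhammer_eval_eq_zero_iff]
  rintro ⟨k, -, hk⟩
  exact hq k (by rw [hk, neg_neg])

/-- The series `₂F₁(-β, q; q + 1; z)` solves the incomplete beta equation, because
`(q)_n / (q + 1)_n = q / (q + n)`. -/
theorem ordinaryHypergeometric_betaEquation {q : ℂ} (hq : ∀ n : ℕ, q ≠ -n) (β : ℂ) {z : ℂ}
    (hz : ‖z‖ < 1) :
    z * deriv (₂F₁ (-β) q (q + 1)) z + q * ₂F₁ (-β) q (q + 1) z = q * (1 - z) ^ β := by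
  rw [← ordinaryHypergeometric_one_one hz]
  refine (hasSum_euler_ordinaryHypergeometric q (-β) q (q + 1) hz).unique
    ((congrArg (fun f => HasSum f _) (funext fun n => ?_)).mpr
      ((hasSum_ordinaryHypergeometric (-β) 1 1 hz).mul_left q))
  have hq1 : ∀ n : ℕ, q + 1 ≠ -n := fun n h => hq (n + 1) (by push_cast; linear_combination h)
  have h1 : (ascPochhammer ℂ n).eval q * (q + n) = q * (ascPochhammer ℂ n).eval (q + 1) := by
    rw [← ascPochhammer_succ_eval, ascPochhammer_succ_left]
    simp
  have h2 := ascPochhammer_eval_ne_zero hq1 n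
  have h3 : (ascPochhammer ℂ n).eval (1 : ℂ) ≠ 0 :=
    ascPochhammer_eval_ne_zero (fun k hk => by
      have := congrArg Complex.re hk
      simp at this
      have hk0 : (0 : ℝ) ≤ k := k.cast_nonneg
      linarith) n
  have h4 : (n.factorial : ℂ) ≠ 0 := by exact_mod_cast n.factorial_ne_zero
  unfold ordinaryHypergeometricCoefficient
  field_simp
  linear_combination ((ascPochhammer ℂ n).eval (-β) * z ^ n) * h1

/-- The series `Y = ₂F₁(B, 1; A + 1; z)` solves a first-order equation:
`(1 - z) z Y' + (A - B z) Y = A`. -/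
theorem ordinaryHypergeometric_one_equation {A : ℂ} (hA : ∀ n : ℕ, A ≠ -n) (B : ℂ) {z : ℂ}
    (hz : ‖z‖ < 1) :
    (1 - z) * (z * deriv (₂F₁ B 1 (A + 1)) z) + (A - B * z) * ₂F₁ B 1 (A + 1) z = A := by
  have hA1 : ∀ n : ℕ, A + 1 ≠ -n := fun n h => hA (n + 1) (by push_cast; linear_combination h)
  have h1 := hasSum_euler_ordinaryHypergeometric A B 1 (A + 1) hz
  rw [← hasSum_nat_add_iff' 1] at h1
  have h2 := (hasSum_euler_ordinaryHypergeometric B B 1 (A + 1) hz).mul_left z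
  have h3 := h1.unique ((congrArg (fun f => HasSum f _) (funext fun n => by
    have hn := ascPochhammer_eval_ne_zero hA1 n
    have hn1 : A + 1 + n ≠ 0 := fun h => hA (n + 1) (by push_cast; linear_combination h)
    have h4 : (n.factorial : ℂ) ≠ 0 := by exact_mod_cast n.factorial_ne_zero
    have h5 : (n : ℂ) + 1 ≠ 0 := by exact_mod_cast n.succ_ne_zero
    unfold ordinaryHypergeometricCoefficient
    simp only [ascPochhammer_succ_eval, Nat.factorial_succ]
    push_cast
    field_simp
    ring)).mpr h2)
  simp [ordinaryHypergeometricCoefficient] at h3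
  linear_combination h3

/-! ### The hypergeometric function as an incomplete beta function -/

/-- The normalized function `₂F₁(-β, q; q + 1; z) / q` on the cut plane `ℂ ∖ [1, +∞)`. -/
noncomputable def reducedBeta (q β z : ℂ) : ℂ := gaussHyp (-β) q (q + 1) z / q

theorem SolvesBetaEquation.eqOn_series {q β : ℂ} (hq : ∀ n : ℕ, q ≠ -n) {f : ℂ → ℂ}
    (hf : SolvesBetaEquation q β f) :
    Set.EqOn (fun z => q * f z) (₂F₁ (-β) q (q + 1)) (Metric.ball 0 1) := by
  have h0 : (0 : ℂ) ∈ Metric.ball (0 : ℂ) 1 := by simp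
  have hfa : AnalyticOnNhd ℂ (fun z => q * f z) (Metric.ball 0 1) :=
    analyticOnNhd_const.mul (hf.analyticOnNhd.mono ball_subset_cutPlane)
  have hga := analyticOnNhd_ordinaryHypergeometric (-β) q (q + 1)
  refine hfa.eqOn_of_preconnected_of_eventuallyEq hga
    (convex_ball (0 : ℂ) 1).isPreconnected h0 ?_
  refine eventuallyEq_of_betaEquation hq (hfa 0 h0) (hga 0 h0) ?_
  filter_upwards [Metric.ball_mem_nhds (0 : ℂ) one_pos] with z hz
  rw [ordinaryHypergeometric_betaEquation hq β (by simpa using hz)]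
  obtain ⟨f', h1, h2⟩ := hf z (ball_subset_cutPlane hz)
  rw [(h1.const_mul q).deriv]
  linear_combination q * h2

theorem SolvesBetaEquation.isGaussContinuation {q β : ℂ} (hq : ∀ n : ℕ, q ≠ -n) {f : ℂ → ℂ}
    (hf : SolvesBetaEquation q β f) :
    IsGaussContinuation (-β) q (q + 1) (fun z => q * f z) :=
  ⟨analyticOnNhd_const.mul hf.analyticOnNhd, hf.eqOn_series hq⟩

theorem solvesBetaEquation_reducedBeta {q : ℂ} (hq : ∀ n : ℕ, q ≠ -n) (β : ℂ) :
    SolvesBetaEquation q β (reducedBeta q β) := by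
  obtain ⟨f, hf⟩ := exists_solvesBetaEquation hq β
  have hq0 : q ≠ 0 := by simpa using hq 0
  have heq : Set.EqOn (reducedBeta q β) f cutPlane := by
    intro z hz
    rw [reducedBeta, (hf.isGaussContinuation hq).eqOn hz]
    field_simp
  intro z hz
  obtain ⟨f', h1, h2⟩ := hf z hz
  refine ⟨f', h1.congr_of_eventuallyEq (heq.eventuallyEq_of_mem (isOpen_cutPlane.mem_nhds hz)), ?_⟩
  rw [heq hz, h2]

theorem reducedBeta_eqOn {q β : ℂ} (hq : ∀ n : ℕ, q ≠ -n) {f : ℂ → ℂ}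
    (hf : SolvesBetaEquation q β f) : Set.EqOn (reducedBeta q β) f cutPlane :=
  (solvesBetaEquation_reducedBeta hq β).eqOn hq hf

/-- Euler's transformation, for the parameters that occur in the connection formulas. -/
theorem reducedBeta_eq_mul_series {A : ℂ} (hA : ∀ n : ℕ, A ≠ -n) (q : ℂ) {w : ℂ}
    (hw : ‖w‖ < 1) :
    reducedBeta A (q - 1) w = (1 - w) ^ q * ₂F₁ (A + q) 1 (A + 1) w / A := by
  have h0 : (0 : ℂ) ∈ Metric.ball (0 : ℂ) 1 := by simp
  have hA0 : A ≠ 0 := by simpa using hA 0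
  have hsol := solvesBetaEquation_reducedBeta hA (q - 1)
  have hfa : AnalyticOnNhd ℂ (reducedBeta A (q - 1)) (Metric.ball 0 1) :=
    hsol.analyticOnNhd.mono ball_subset_cutPlane
  have hYa := analyticOnNhd_ordinaryHypergeometric (A + q) 1 (A + 1)
  have hd : ∀ z ∈ Metric.ball (0 : ℂ) 1,
      HasDerivAt (fun w => (1 - w) ^ q * ₂F₁ (A + q) 1 (A + 1) w / A)
        ((-q * (1 - z) ^ (q - 1) * ₂F₁ (A + q) 1 (A + 1) z +
          (1 - z) ^ q * deriv (₂F₁ (A + q) 1 (A + 1)) z) / A) z := fun z hz =>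
    ((hasDerivAt_one_sub_cpow (mem_cutPlane_iff.1 (ball_subset_cutPlane hz)) q).mul
      (hYa z hz).differentiableAt.hasDerivAt).div_const A
  have hga : AnalyticOnNhd ℂ (fun w => (1 - w) ^ q * ₂F₁ (A + q) 1 (A + 1) w / A)
      (Metric.ball 0 1) :=
    DifferentiableOn.analyticOnNhd
      (fun z hz => (hd z hz).differentiableAt.differentiableWithinAt) Metric.isOpen_ball
  refine hfa.eqOn_of_preconnected_of_eventuallyEq hga
    (convex_ball (0 : ℂ) 1).isPreconnected h0 ?_ (by simpa using hw)
  refine eventuallyEq_of_betaEquation hA (hfa 0 h0) (hga 0 h0) ?_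
  filter_upwards [Metric.ball_mem_nhds (0 : ℂ) one_pos] with z hz
  obtain ⟨f', h1, h2⟩ := hsol z (ball_subset_cutPlane hz)
  rw [h1.deriv, h2, (hd z hz).deriv]
  have h3 := ordinaryHypergeometric_one_equation hA (A + q) (z := z) (by simpa using hz)
  have h4 := cpow_eq_mul_cpow_sub_one
    (Complex.slitPlane_ne_zero (mem_cutPlane_iff.1 (ball_subset_cutPlane hz))) q
  rw [h4]
  field_simp
  linear_combination (-(1 - z) ^ (q - 1)) * h3

/-- Pfaff's transformation. It exchanges the exponents `β` and `γ`. -/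
theorem reducedBeta_pfaff {q β γ : ℂ} (hq : ∀ n : ℕ, q ≠ -n) (h : q + β + γ + 1 = 0) {w : ℂ}
    (hw : w ∈ Complex.slitPlane) :
    reducedBeta q β (1 - w) = w ^ (-q) * reducedBeta q γ (1 - w⁻¹) := by
  have hmain : SolvesBetaEquation q β
      (fun z => (1 - z) ^ (-q) * reducedBeta q γ (1 - (1 - z)⁻¹)) := by
    intro z hz
    have hsl := mem_cutPlane_iff.1 hz
    have hne := Complex.slitPlane_ne_zero hsl
    have hinv : (1 - z)⁻¹ ∈ Complex.slitPlane := inv_mem_slitPlane hsl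
    obtain ⟨g', h1, h2⟩ := solvesBetaEquation_reducedBeta hq γ (1 - (1 - z)⁻¹)
      (mem_cutPlane_iff.2 (by simpa using hinv))
    have d1 : HasDerivAt (fun z : ℂ => 1 - (1 - z)⁻¹) (-(1 / (1 - z) ^ 2)) z := by
      simpa using (((hasDerivAt_id z).const_sub 1).inv hne).const_sub 1
    have d2 := (hasDerivAt_one_sub_cpow hsl (-q)).mul (h1.comp z d1)
    refine ⟨_, d2, ?_⟩
    have e1 := cpow_eq_mul_cpow_sub_one hne (-q)
    rw [sub_sub_cancel, Complex.inv_cpow _ _ (Complex.slitPlane_arg_ne_pi hsl),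
      ← Complex.cpow_neg] at h2
    have e2 : (1 - z) ^ β = (1 - z) ^ (-q - 1) * (1 - z) ^ (-γ) := by
      rw [← Complex.cpow_add _ _ hne]
      congr 1
      linear_combination h
    rw [e2, ← h2]
    simp only [Function.comp_apply]
    rw [e1]
    field_simp
    ring
  have := reducedBeta_eqOn hq hmain (x := 1 - w) (mem_cutPlane_iff.2 (by simpa using hw))
  simpa using this

/-! ### The connection formula between `z = 0` and `z = 1` -/

/-- The plane cut along both `(-∞, 0]` and `[1, +∞)`. -/
def doublyCutPlane : Set ℂ := {z | z ∈ Complex.slitPlane ∧ 1 - z ∈ Complex.slitPlane}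

theorem isOpen_doublyCutPlane : IsOpen doublyCutPlane :=
  Complex.isOpen_slitPlane.inter (Complex.isOpen_slitPlane.preimage (by fun_prop))

theorem isPreconnected_doublyCutPlane : IsPreconnected doublyCutPlane := by
  have hs : StarConvex ℝ ((1 / 2 : ℝ) : ℂ) doublyCutPlane := by
    have h0 := Complex.starConvex_ofReal_slitPlane (x := 1 / 2) (by norm_num)
    intro z hz a b ha hb hab
    refine ⟨h0 hz.1 ha hb hab, ?_⟩
    have := h0 hz.2 ha hb hab
    convert this using 1
    have hab' : (a : ℂ) + b = 1 := by exact_mod_cast hab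
    simp only [Complex.real_smul]
    push_cast
    linear_combination -hab'
  exact (hs.isPathConnected
    ⟨by norm_num [Complex.mem_slitPlane_iff],
    by norm_num [Complex.mem_slitPlane_iff]⟩).isConnected.isPreconnected

/-- The difference of the primitives of `z ^ (q - 1) * (1 - z) ^ (A - 1)` based at `0` and at
`1`. -/
noncomputable def betaConnection (q A z : ℂ) : ℂ :=
  z ^ q * reducedBeta q (A - 1) z + (1 - z) ^ A * reducedBeta A (q - 1) (1 - z)

theorem betaConnection_one_sub (q A z : ℂ) : betaConnection A q (1 - z) = betaConnection q A z := by
  simp only [betaConnection, sub_sub_cancel]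
  ring

/-- `z ^ q * reducedBeta q β z` is a primitive of `z ^ (q - 1) * (1 - z) ^ β`. -/
theorem hasDerivAt_cpow_mul_reducedBeta {q : ℂ} (hq : ∀ n : ℕ, q ≠ -n) (β : ℂ) {z : ℂ}
    (hz : z ∈ doublyCutPlane) :
    HasDerivAt (fun z => z ^ q * reducedBeta q β z) (z ^ (q - 1) * (1 - z) ^ β) z := by
  obtain ⟨f', h1, h2⟩ := solvesBetaEquation_reducedBeta hq β z (mem_cutPlane_iff.2 hz.2)
  have d1 : HasDerivAt (fun z : ℂ => z ^ q) (q * z ^ (q - 1)) z := by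
    simpa using (hasDerivAt_id z).cpow_const (c := q) hz.1
  refine (d1.mul h1).congr_deriv ?_
  rw [← h2, cpow_eq_mul_cpow_sub_one (Complex.slitPlane_ne_zero hz.1) q]
  ring

theorem betaConnection_eqOn_const {q A : ℂ} (hq : ∀ n : ℕ, q ≠ -n) (hA : ∀ n : ℕ, A ≠ -n) :
    ∃ L, ∀ z ∈ doublyCutPlane, betaConnection q A z = L := by
  have hd : ∀ z ∈ doublyCutPlane, HasDerivAt (betaConnection q A) 0 z := by
    intro z hz
    have hz' : 1 - z ∈ doublyCutPlane := ⟨hz.2, by simpa using hz.1⟩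
    have d2 := (hasDerivAt_cpow_mul_reducedBeta hA (q - 1) hz').comp z
      ((hasDerivAt_id z).const_sub 1)
    refine ((hasDerivAt_cpow_mul_reducedBeta hq (A - 1) hz).add d2).congr_deriv ?_
    simp only [sub_sub_cancel]
    ring
  exact isOpen_doublyCutPlane.exists_is_const_of_deriv_eq_zero isPreconnected_doublyCutPlane
    (fun z hz => (hd z hz).differentiableAt.differentiableWithinAt) fun z hz => (hd z hz).deriv

theorem ne_neg_natCast_of_re_pos {q : ℂ} (hq : 0 < q.re) (n : ℕ) : q ≠ -n := by
  rintro rfl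
  have : (0 : ℝ) ≤ n := n.cast_nonneg
  simp at hq
  linarith

theorem tendsto_cpow_mul_reducedBeta_zero {q : ℂ} (hq : 0 < q.re) (β : ℂ) :
    Filter.Tendsto (fun x : ℝ => (x : ℂ) ^ q * reducedBeta q β x) (nhds 0) (nhds 0) := by
  have hq0 : q ≠ 0 := by rintro rfl; simp at hq
  have h1 := (Complex.continuous_ofReal_cpow_const hq).tendsto 0
  have h2 := ((solvesBetaEquation_reducedBeta (ne_neg_natCast_of_re_pos hq) β).analyticOnNhd 0
    zero_mem_cutPlane).continuousAt
  have h3 : Filter.Tendsto (fun x : ℝ => reducedBeta q β x) (nhds 0) (nhds (reducedBeta q β 0)) :=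
    h2.tendsto.comp (by simpa using Complex.continuous_ofReal.tendsto 0)
  simpa [Complex.zero_cpow hq0] using h1.mul h3

/-- For positive real parts the connection constant is the beta integral. -/
theorem betaConnection_eq_of_re_pos {q A : ℂ} (hq : 0 < q.re) (hA : 0 < A.re) {z : ℂ}
    (hz : z ∈ doublyCutPlane) :
    betaConnection q A z = Complex.Gamma q * Complex.Gamma A / Complex.Gamma (q + A) := by
  have hq' := ne_neg_natCast_of_re_pos hq
  have hA' := ne_neg_natCast_of_re_pos hA
  obtain ⟨L, hL⟩ := betaConnection_eqOn_const hq' hA'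
  rw [hL z hz, ← Complex.betaIntegral_eq_Gamma_mul_div q A hq hA, Complex.betaIntegral]
  have hmem : ∀ x ∈ Set.Ioo (0 : ℝ) 1, (x : ℂ) ∈ doublyCutPlane := fun x hx =>
    ⟨by simp [hx.1], by simp [Complex.mem_slitPlane_iff, hx.2]⟩
  -- the primitive extends continuously to both end points, by `0` and by `L`
  rw [intervalIntegral.integral_eq_sub_of_hasDerivAt_of_tendsto (fa := 0) (fb := L)
    (f := fun x : ℝ => (x : ℂ) ^ q * reducedBeta q (A - 1) x) one_pos
    (fun x hx => (hasDerivAt_cpow_mul_reducedBeta hq' (A - 1) (hmem x hx)).comp_ofReal)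
    (Complex.betaIntegral_convergent hq hA)
    ((tendsto_cpow_mul_reducedBeta_zero hq (A - 1)).mono_left nhdsWithin_le_nhds), sub_zero]
  have h1 : Filter.Tendsto (fun x : ℝ => 1 - x) (nhds 1) (nhds 0) := by
    have : Continuous fun x : ℝ => 1 - x := by fun_prop
    simpa using this.tendsto 1
  have h2 := (((tendsto_cpow_mul_reducedBeta_zero hA (q - 1)).comp h1).const_sub L).mono_left
    (nhdsWithin_le_nhds (s := Set.Iio 1))
  rw [sub_zero] at h2
  refine h2.congr' ?_
  filter_upwards [Ioo_mem_nhdsLT (one_pos (α := ℝ))] with x hx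
  rw [← hL x (hmem x hx)]
  simp [betaConnection]

/-- The contiguity relation of the connection constant, the same as that of the beta function. -/
theorem betaConnection_recurrence {q A : ℂ} (hq : ∀ n : ℕ, q ≠ -n) (hA : ∀ n : ℕ, A ≠ -n) {z : ℂ}
    (hz : z ∈ doublyCutPlane) :
    A * betaConnection q A z = (q + A) * betaConnection q (A + 1) z := by
  have hA0 : A ≠ 0 := by simpa using hA 0
  have hA1 : ∀ n : ℕ, A + 1 ≠ -n := fun n h => hA (n + 1) (by push_cast; linear_combination h)
  have h1 := reducedBeta_eqOn hq ((solvesBetaEquation_reducedBeta hq A).lower_exponent hA0)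
    (mem_cutPlane_iff.2 hz.2)
  have h2 := reducedBeta_eqOn hA ((solvesBetaEquation_reducedBeta hA1 (q - 1)).lower hA0)
    (x := 1 - z) (mem_cutPlane_iff.2 (by simpa using hz.1))
  simp only [betaConnection, add_sub_cancel_right]
  simp only [sub_sub_cancel, sub_add_cancel] at h1 h2
  rw [h1, h2, Complex.cpow_add _ _ (Complex.slitPlane_ne_zero hz.2), Complex.cpow_one]
  field_simp
  ring

theorem betaConnection_eq_of_re_pos_left {q A : ℂ} (hq : 0 < q.re) (hA : ∀ n : ℕ, A ≠ -n) {z : ℂ}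
    (hz : z ∈ doublyCutPlane) :
    betaConnection q A z = Complex.Gamma q * Complex.Gamma A / Complex.Gamma (q + A) := by
  obtain ⟨N, hN⟩ := exists_nat_gt (-A.re)
  induction N generalizing A with
  | zero => exact betaConnection_eq_of_re_pos hq (by simpa using hN) hz
  | succ N ih =>
    have hA0 : A ≠ 0 := by simpa using hA 0
    have h1 := ih (A := A + 1) (fun n h => hA (n + 1) (by push_cast; linear_combination h))
      (by push_cast at hN; simp; linarith)
    have h2 := betaConnection_recurrence (ne_neg_natCast_of_re_pos hq) hA hz
    rw [h1, Complex.Gamma_add_one A hA0, ← add_assoc] at h2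
    refine mul_left_cancel₀ hA0 (h2.trans ?_)
    -- if `q + A = 0` both sides vanish, since `1 / Γ(0) = 0`
    by_cases hqA : q + A = 0
    · simp [hqA]
    · rw [Complex.Gamma_add_one _ hqA]
      field_simp

/-- **Connection formula**. The constant is the meromorphic continuation of the beta function. -/
theorem betaConnection_eq {q A : ℂ} (hq : ∀ n : ℕ, q ≠ -n) (hA : ∀ n : ℕ, A ≠ -n) {z : ℂ}
    (hz : z ∈ doublyCutPlane) :
    betaConnection q A z = Complex.Gamma q * Complex.Gamma A / Complex.Gamma (q + A) := by
  have hz' : 1 - z ∈ doublyCutPlane := ⟨hz.2, by simpa using hz.1⟩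
  obtain ⟨N, hN⟩ := exists_nat_gt (-q.re)
  induction N generalizing q with
  | zero => exact betaConnection_eq_of_re_pos_left (by simpa using hN) hA hz
  | succ N ih =>
    have hq0 : q ≠ 0 := by simpa using hq 0
    have h1 := ih (q := q + 1) (fun n h => hq (n + 1) (by push_cast; linear_combination h))
      (by push_cast at hN; simp; linarith)
    have h2 := betaConnection_recurrence hA hq hz'
    rw [betaConnection_one_sub, betaConnection_one_sub, h1, Complex.Gamma_add_one q hq0] at h2
    refine mul_left_cancel₀ hq0 (h2.trans ?_)
    -- as before, both sides vanish if `q + A = 0`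
    by_cases hqA : q + A = 0
    · simp [hqA, add_comm A q]
    · rw [show q + 1 + A = q + A + 1 by ring, Complex.Gamma_add_one _ hqA, add_comm A q]
      field_simp

/-! ### Expansions of the hypergeometric function in powers of `1 - z` -/

theorem gaussHyp_eq_mul_reducedBeta {q : ℂ} (hq : ∀ n : ℕ, q ≠ -n) (β z : ℂ) :
    gaussHyp (-β) q (q + 1) z = q * reducedBeta q β z := by
  have hq0 : q ≠ 0 := by simpa using hq 0
  rw [reducedBeta]
  field_simp

/-- The connection formula, with the solution based at `1` expanded by Euler's transformation. -/
theorem gaussHyp_eq_of_norm_lt_one {q β : ℂ} (hq : ∀ n : ℕ, q ≠ -n)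
    (hβ : ∀ n : ℕ, β + 1 ≠ -n) {w : ℂ} (hw : w ∈ Complex.slitPlane) (hw1 : ‖w‖ < 1) :
    gaussHyp (-β) q (q + 1) (1 - w) =
      Complex.Gamma (q + 1) * Complex.Gamma (1 + β) / Complex.Gamma (q + β + 1) * (1 - w) ^ (-q) +
        -q / (β + 1) * w ^ (1 + β) * gaussHyp (q + β + 1) 1 (β + 2) w := by
  have hq0 : q ≠ 0 := by simpa using hq 0
  have hβ0 : β + 1 ≠ 0 := by simpa using hβ 0
  have hsl : 1 - w ∈ Complex.slitPlane :=
    mem_cutPlane_iff.1 (ball_subset_cutPlane (by simpa using hw1))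
  have hne := Complex.slitPlane_ne_zero hsl
  have h1 := betaConnection_eq hq hβ (z := 1 - w) ⟨hsl, by simpa using hw⟩
  rw [betaConnection, sub_sub_cancel, reducedBeta_eq_mul_series hβ q hw1,
    add_sub_cancel_right] at h1
  rw [gaussHyp_eqOn_ball (q + β + 1) 1 (β + 2) (by simpa using hw1),
    gaussHyp_eq_mul_reducedBeta hq, Complex.Gamma_add_one q hq0, Complex.cpow_neg,
    add_comm (1 : ℂ) β, show q + β + 1 = q + (β + 1) by ring]
  rw [show β + 1 + q = q + (β + 1) by ring, show β + 1 + 1 = β + 2 by ring] at h1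
  have hp : (1 - w) ^ q ≠ 0 := by simp [Complex.cpow_eq_zero_iff, hne]
  rw [mul_assoc q, mul_div_assoc q, ← h1]
  field_simp
  ring

/-- The Pfaff transformation carries this case to the preceding one, at `w⁻¹` and with `γ` in place
of `β`. -/
theorem gaussHyp_eq_of_one_lt_norm {q β γ : ℂ} (hq : ∀ n : ℕ, q ≠ -n)
    (hγ : ∀ n : ℕ, γ + 1 ≠ -n) (h : q + β + γ + 1 = 0) {w : ℂ} (hw : w ∈ Complex.slitPlane)
    (hw1 : 1 < ‖w‖) :
    gaussHyp (-β) q (q + 1) (1 - w) =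
      Complex.Gamma (q + 1) * Complex.Gamma (1 + γ) / Complex.Gamma (-β) *
          w⁻¹ ^ q * (1 - w⁻¹) ^ (-q) +
        -q / (γ + 1) * w⁻¹ ^ (-β) * gaussHyp (-β) 1 (γ + 2) w⁻¹ := by
  have hne : w⁻¹ ≠ 0 := inv_ne_zero (Complex.slitPlane_ne_zero hw)
  have h1 := gaussHyp_eq_of_norm_lt_one hq hγ (inv_mem_slitPlane hw)
    (by rw [norm_inv]; exact inv_lt_one_of_one_lt₀ hw1)
  rw [gaussHyp_eq_mul_reducedBeta hq] at h1
  have hpow : w⁻¹ ^ (-β) = w⁻¹ ^ q * w⁻¹ ^ (1 + γ) := by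
    rw [← Complex.cpow_add _ _ hne]
    congr 1
    linear_combination -h
  rw [gaussHyp_eq_mul_reducedBeta hq, reducedBeta_pfaff hq h hw, Complex.cpow_neg,
    ← Complex.inv_cpow _ _ (Complex.slitPlane_arg_ne_pi hw), mul_left_comm, h1,
    show q + γ + 1 = -β by linear_combination h, hpow]
  ring

/-! ### Quotients in the slit plane -/

theorem div_mem_slitPlane {x y : ℂ} (hx : 0 < x.re) (hy : 0 < y.re) :
    x / y ∈ Complex.slitPlane := by
  by_contra hn
  rw [Complex.mem_slitPlane_iff] at hn
  push Not at hn
  have hy0 : y ≠ 0 := by rintro rfl; simp at hy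
  have h1 : x.re = (x / y * y).re := by rw [div_mul_cancel₀ _ hy0]
  rw [Complex.mul_re, hn.2] at h1
  nlinarith [hn.1]

theorem div_cpow_of_re_pos {x y : ℂ} (hx : 0 < x.re) (hy : 0 < y.re) (β : ℂ) :
    (x / y) ^ β = x ^ β / y ^ β := by
  have hx0 : x ≠ 0 := by rintro rfl; simp at hx
  have hy0 : y ≠ 0 := by rintro rfl; simp at hy
  have h1 := abs_lt.1 (Complex.abs_arg_lt_pi_div_two_iff.2 (Or.inl hx))
  have h2 := abs_lt.1 (Complex.abs_arg_lt_pi_div_two_iff.2 (Or.inl hy))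
  have hyπ : y.arg ≠ Real.pi := by linarith [Real.pi_pos]
  rw [div_eq_mul_inv, Complex.cpow_def_of_ne_zero (mul_ne_zero hx0 (inv_ne_zero hy0)),
    Complex.log_mul hx0 (inv_ne_zero hy0), Complex.log_inv _ hyπ,
    Complex.cpow_def_of_ne_zero hx0, Complex.cpow_def_of_ne_zero hy0, ← Complex.exp_sub]
  · congr 1
    ring
  · rw [Complex.arg_inv, if_neg hyπ]
    constructor <;> linarith

theorem sub_div_sub_eq {s a b : ℂ} (h : s - b ≠ 0) : (a - b) / (s - b) = 1 - (s - a) / (s - b) := by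
  field_simp
  ring

/-! ### The integral -/

section Integral

open MeasureTheory

theorem re_neg_I_mul_sub (u : ℝ) (b : ℂ) : (-Complex.I * ((u : ℂ) - b)).re = -b.im := by simp

theorem neg_I_mul_sub_mem_slitPlane {u : ℝ} {b : ℂ} (hu : u ≠ b.re) :
    -Complex.I * ((u : ℂ) - b) ∈ Complex.slitPlane := by
  refine Or.inr ?_
  simpa [sub_eq_zero] using hu.symm

theorem neg_I_mul_sub_mem_slitPlane_of_im_neg (u : ℝ) {a : ℂ} (ha : a.im < 0) :
    -Complex.I * ((u : ℂ) - a) ∈ Complex.slitPlane :=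
  Or.inl (by rw [re_neg_I_mul_sub]; linarith)

theorem continuousOn_neg_I_mul_sub_cpow (t : ℝ) (γ : ℂ) :
    ContinuousOn (fun p : ℂ × ℝ => (-Complex.I * ((p.2 : ℂ) - p.1)) ^ γ)
      ({a : ℂ | a.im < 0} ×ˢ Set.Icc 0 t) :=
  ContinuousOn.cpow_const (by fun_prop)
    fun p hp => neg_I_mul_sub_mem_slitPlane_of_im_neg p.2 hp.1

/-- A bound that depends on `b` only through its real part and an upper bound `M`, for either sign
of the exponent. -/
theorem norm_neg_I_mul_sub_cpow_le {β : ℝ} {u M : ℝ} {b : ℂ} (hu : u ≠ b.re)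
    (hM : ‖(u : ℂ) - b‖ ≤ M) :
    ‖(-Complex.I * ((u : ℂ) - b)) ^ (β : ℂ)‖ ≤ |u - b.re| ^ β + M ^ β := by
  have hpos : 0 < |u - b.re| := abs_pos.2 (sub_ne_zero.2 hu)
  have hle : |u - b.re| ≤ ‖(u : ℂ) - b‖ := by
    simpa using Complex.abs_re_le_norm ((u : ℂ) - b)
  rw [Complex.norm_cpow_real, norm_mul, norm_neg, Complex.norm_I, one_mul]
  rcases le_total β 0 with h | h
  · exact (Real.rpow_le_rpow_of_nonpos hpos hle h).trans
      (le_add_of_nonneg_right (Real.rpow_nonneg ((norm_nonneg _).trans hM) _))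
  · exact (Real.rpow_le_rpow (norm_nonneg _) hM h).trans
      (le_add_of_nonneg_left (Real.rpow_nonneg hpos.le _))

theorem intervalIntegrable_abs_sub_rpow {β : ℝ} (hβ : -1 < β) (c t : ℝ) :
    IntervalIntegrable (fun u : ℝ => |u - c| ^ β) volume 0 t := by
  have h := ((intervalIntegral.intervalIntegrable_cpow' (a := 0 - c) (b := t - c) (r := β)
    (by simpa using hβ)).norm).comp_sub_right c
  simpa [Complex.norm_cpow_real, ← Complex.ofReal_sub, Complex.norm_real] using h

theorem ae_ne_real (c : ℝ) : ∀ᵐ u : ℝ, u ≠ c := by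
  simp [ae_iff, measure_singleton]

theorem intervalIntegrable_neg_I_mul_sub_cpow {β t : ℝ} (hβ : -1 < β) (ht : 0 ≤ t) (b : ℂ) :
    IntervalIntegrable (fun u : ℝ => (-Complex.I * ((u : ℂ) - b)) ^ (β : ℂ)) volume 0 t := by
  refine ((intervalIntegrable_abs_sub_rpow hβ b.re t).add
    (intervalIntegrable_const (c := (t + ‖b‖) ^ β))).mono_fun
    (Measurable.aestronglyMeasurable (by fun_prop)) ?_
  rw [Filter.EventuallyLE, ae_restrict_iff' measurableSet_uIoc]
  filter_upwards [ae_ne_real b.re] with u hu hut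
  rw [Set.uIoc_of_le ht] at hut
  refine (norm_neg_I_mul_sub_cpow_le hu ?_).trans (le_abs_self _)
  refine (norm_sub_le _ _).trans ?_
  gcongr
  simpa [abs_of_pos hut.1] using hut.2

theorem intervalIntegrable_integrandMinus_and_differentiableAt {β₁ β₂ t : ℝ}
    (hβ₂ : -1 < β₂) (ht : 0 < t) {a : ℂ} (ha : a.im < 0) (b : ℂ) :
    IntervalIntegrable (integrandMinus β₁ β₂ a b) volume 0 t ∧
      DifferentiableAt ℂ (fun a => integralMinus β₁ β₂ t a b) a := by
  obtain ⟨h1, -, h2⟩ := hasDerivAt_intervalIntegral_mul (U := {a : ℂ | a.im < 0})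
    (isOpen_lt Complex.continuous_im continuous_const)
    (k := fun a u => (-Complex.I * ((u : ℂ) - a)) ^ (β₁ : ℂ))
    (k' := fun a u => β₁ * (-Complex.I * ((u : ℂ) - a)) ^ ((β₁ : ℂ) - 1) * Complex.I) ht.le
    (intervalIntegrable_neg_I_mul_sub_cpow hβ₂ ht.le b)
    (continuousOn_neg_I_mul_sub_cpow t β₁)
    ((continuousOn_const.mul (continuousOn_neg_I_mul_sub_cpow t ((β₁ : ℂ) - 1))).mul
      continuousOn_const)
    (by
      intro z hz u _
      have := (((hasDerivAt_id z).const_sub (u : ℂ)).const_mul (-Complex.I)).cpow_const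
        (c := (β₁ : ℂ)) (neg_I_mul_sub_mem_slitPlane_of_im_neg u hz)
      refine this.congr_deriv ?_
      simp) ha
  exact ⟨h1, h2.differentiableAt⟩

/-- The integral is continuous when `b` is approached from below. -/
theorem tendsto_integralMinus {β₁ β₂ t : ℝ} (hβ₂ : -1 < β₂) (ht : 0 < t)
    {a : ℂ} (ha : a.im < 0) (b : ℂ) :
    Filter.Tendsto (fun ε : ℝ => integralMinus β₁ β₂ t a (b - ε * Complex.I))
      (nhdsWithin 0 (Set.Ioi 0)) (nhds (integralMinus β₁ β₂ t a b)) := by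
  have hcont : ContinuousOn (fun u : ℝ => (-Complex.I * ((u : ℂ) - a)) ^ (β₁ : ℂ))
      (Set.Icc 0 t) :=
    (continuousOn_neg_I_mul_sub_cpow t β₁).comp (f := fun u : ℝ => (a, u)) (by fun_prop)
      fun u hu => ⟨ha, hu⟩
  obtain ⟨C, hC⟩ := isCompact_Icc.exists_bound_of_continuousOn hcont
  unfold integralMinus
  refine intervalIntegral.tendsto_integral_filter_of_dominated_convergence
    (fun u => C * (|u - b.re| ^ β₂ + (t + (‖b‖ + 1)) ^ β₂)) ?_ ?_ ?_ ?_
  · refine Filter.Eventually.of_forall fun ε => Measurable.aestronglyMeasurable ?_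
    unfold integrandMinus
    fun_prop
  · filter_upwards [Ioo_mem_nhdsGT (one_pos (α := ℝ))] with ε hε
    filter_upwards [ae_ne_real b.re] with u hu hut
    rw [Set.uIoc_of_le ht.le] at hut
    rw [integrandMinus, norm_mul]
    have h1 := hC u ⟨hut.1.le, hut.2⟩
    have h2 := norm_neg_I_mul_sub_cpow_le (β := β₂) (u := u) (M := t + (‖b‖ + 1))
      (b := b - ε * Complex.I) (by simpa using hu) (by
        refine (norm_sub_le _ _).trans ?_
        gcongr
        · simpa [abs_of_pos hut.1] using hut.2
        · refine (norm_sub_le _ _).trans ?_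
          gcongr
          simpa [abs_of_pos hε.1] using hε.2.le)
    simp only [Complex.sub_re, Complex.mul_re, Complex.ofReal_re, Complex.I_re, mul_zero,
      Complex.ofReal_im, Complex.I_im, mul_one, sub_zero] at h2
    exact mul_le_mul h1 h2 (norm_nonneg _) ((norm_nonneg _).trans h1)
  · exact ((intervalIntegrable_abs_sub_rpow hβ₂ b.re t).add intervalIntegrable_const).const_mul C
  · filter_upwards [ae_ne_real b.re] with u hu _
    refine Filter.Tendsto.mono_left ?_ (nhdsWithin_le_nhds (s := Set.Ioi 0))
    have : ContinuousAt (fun ε : ℝ => integrandMinus β₁ β₂ a (b - ε * Complex.I) u) 0 := by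
      unfold integrandMinus
      refine continuousAt_const.mul (ContinuousAt.cpow (by fun_prop) continuousAt_const ?_)
      simpa using neg_I_mul_sub_mem_slitPlane hu
    simpa using this.tendsto

end Integral

/-! ### The function `Φ` and the closed formula -/

theorem Phi_eq {β₁ β₂ : ℝ} (s : ℝ) (a b : ℂ) {q : ℂ} (hq : q = -((β₁ : ℂ) + β₂ + 1)) :
    Phi β₁ β₂ s a b =
      (-Complex.I * ((s : ℂ) - b)) ^ (-q) * gaussHyp (-β₁) q (q + 1) ((a - b) / (s - b)) := by
  rw [Phi, hq]
  congr 2 <;> ring_nf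

theorem ne_neg_natCast_of_add_ne {β₁ β₂ : ℝ} (hσ : ∀ n : ℕ, β₁ + β₂ + 1 ≠ n) (n : ℕ) :
    -((β₁ : ℂ) + β₂ + 1) ≠ -n := by
  rw [Ne, neg_inj]
  exact_mod_cast hσ n

theorem analyticAt_gaussHyp {q : ℂ} (hq : ∀ n : ℕ, q ≠ -n) (β : ℂ) {z : ℂ} (hz : z ∈ cutPlane) :
    AnalyticAt ℂ (gaussHyp (-β) q (q + 1)) z := by
  have h := analyticAt_const.mul ((solvesBetaEquation_reducedBeta hq β).analyticOnNhd z hz)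
    (f := fun _ => q)
  refine h.congr (Filter.Eventually.of_forall fun w => ?_)
  exact (gaussHyp_eq_mul_reducedBeta hq β w).symm

/-- `Φ` is a primitive of the integrand, up to the factor `-i (β₁ + β₂ + 1)`, as a function of its
base point. -/
theorem hasDerivAt_Phi {β₁ β₂ : ℝ} (hσ : ∀ n : ℕ, β₁ + β₂ + 1 ≠ n) {a b : ℂ}
    (ha : a.im < 0) (hb : b.im < 0) (u : ℝ) :
    HasDerivAt (fun u : ℝ => Phi β₁ β₂ u a b)
      (-Complex.I * ((β₁ : ℂ) + β₂ + 1) * integrandMinus β₁ β₂ a b u) u := by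
  obtain ⟨q, hq⟩ : ∃ q : ℂ, q = -((β₁ : ℂ) + β₂ + 1) := ⟨_, rfl⟩
  have hqn : ∀ n : ℕ, q ≠ -n := hq ▸ ne_neg_natCast_of_add_ne hσ
  have hσq : (β₁ : ℂ) + β₂ + 1 = -q := by rw [hq, neg_neg]
  have hare : 0 < (-Complex.I * ((u : ℂ) - a)).re := by rw [re_neg_I_mul_sub]; linarith
  have hbre : 0 < (-Complex.I * ((u : ℂ) - b)).re := by rw [re_neg_I_mul_sub]; linarith
  have hbne : -Complex.I * ((u : ℂ) - b) ≠ 0 := by intro h; rw [h] at hbre; simp at hbre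
  have hub : (u : ℂ) - b ≠ 0 := right_ne_zero_of_mul hbne
  have hdiv : ((u : ℂ) - a) / (u - b) =
      (-Complex.I * ((u : ℂ) - a)) / (-Complex.I * ((u : ℂ) - b)) := by
    rw [mul_div_mul_left _ _ (neg_ne_zero.2 Complex.I_ne_zero)]
  have hz : (a - b) / (u - b) ∈ cutPlane := by
    rw [mem_cutPlane_iff, sub_div_sub_eq hub, sub_sub_cancel, hdiv]
    exact div_mem_slitPlane hare hbre
  obtain ⟨g', hg, he⟩ := solvesBetaEquation_reducedBeta hqn β₁ _ hz
  rw [sub_div_sub_eq hub, sub_sub_cancel, hdiv, div_cpow_of_re_pos hare hbre,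
    ← hdiv, ← sub_div_sub_eq hub] at he
  have d1 : HasDerivAt (fun x : ℂ => (-Complex.I * (x - b)) ^ (-q))
      (-q * (-Complex.I * ((u : ℂ) - b)) ^ (-q - 1) * -Complex.I) u := by
    simpa using (((hasDerivAt_id (u : ℂ)).sub_const b).const_mul (-Complex.I)).cpow_const
      (c := -q) (neg_I_mul_sub_mem_slitPlane_of_im_neg u hb)
  have d2 : HasDerivAt (fun x : ℂ => (a - b) / (x - b)) (-(a - b) / ((u : ℂ) - b) ^ 2) u := by
    refine ((((hasDerivAt_id (u : ℂ)).sub_const b).inv hub).const_mul (a - b)).congr_deriv ?_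
    simp only [id_eq]
    ring
  have d3 := (d1.mul ((hg.comp (u : ℂ) d2).const_mul q)).comp_ofReal
  have hfun : (fun u : ℝ => Phi β₁ β₂ u a b) = fun u : ℝ => (-Complex.I * ((u : ℂ) - b)) ^ (-q) *
      (q * reducedBeta q β₁ ((a - b) / (u - b))) := by
    funext x
    rw [Phi_eq x a b hq, gaussHyp_eq_mul_reducedBeta hqn]
  rw [hfun]
  refine d3.congr_deriv ?_
  have e1 := cpow_eq_mul_cpow_sub_one hbne (-q)
  have e2 : (-Complex.I * ((u : ℂ) - b)) ^ (-q - 1) =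
      (-Complex.I * ((u : ℂ) - b)) ^ (β₁ : ℂ) * (-Complex.I * ((u : ℂ) - b)) ^ (β₂ : ℂ) := by
    rw [← Complex.cpow_add _ _ hbne]
    congr 1
    linear_combination -hσq
  have hP : (-Complex.I * ((u : ℂ) - b)) ^ (β₁ : ℂ) ≠ 0 := by
    simp only [Ne, Complex.cpow_eq_zero_iff, hbne, false_and, not_false_eq_true]
  rw [integrandMinus, hσq]
  simp only [Function.comp_apply]
  rw [e1, e2]
  rw [eq_div_iff hP] at he
  have hI : (-Complex.I * ((u : ℂ) - b)) * (-(a - b) / ((u : ℂ) - b) ^ 2) =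
      Complex.I * ((a - b) / (u - b)) := by
    field_simp
  linear_combination (Complex.I * q * (-Complex.I * ((u : ℂ) - b)) ^ (β₂ : ℂ)) * he +
    ((-Complex.I * ((u : ℂ) - b)) ^ (β₁ : ℂ) * (-Complex.I * ((u : ℂ) - b)) ^ (β₂ : ℂ) *
      q * g') * hI

theorem integralMinus_eq_of_im_neg {β₁ β₂ t : ℝ} (hβ₂ : -1 < β₂) (ht : 0 < t)
    (hσ : ∀ n : ℕ, β₁ + β₂ + 1 ≠ n) {a b : ℂ} (ha : a.im < 0) (hb : b.im < 0) :
    integralMinus β₁ β₂ t a b =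
      Complex.I / ((β₁ : ℂ) + β₂ + 1) * (Phi β₁ β₂ t a b - Phi β₁ β₂ 0 a b) := by
  have hσ0 : (β₁ : ℂ) + β₂ + 1 ≠ 0 := by exact_mod_cast hσ 0
  have h := intervalIntegral.integral_eq_sub_of_hasDerivAt (a := 0) (b := t)
    (fun u _ => hasDerivAt_Phi hσ ha hb u)
    ((intervalIntegrable_integrandMinus_and_differentiableAt hβ₂ ht ha b).1.const_mul _)
  rw [intervalIntegral.integral_const_mul] at h
  rw [integralMinus, ← h]
  field_simp
  linear_combination (∫ u in (0 : ℝ)..t, integrandMinus β₁ β₂ a b u) * Complex.I_sq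

theorem div_mem_slitPlane_of_mem_strip {t s : ℝ} (hs : s = 0 ∨ s = t) {a b : ℂ}
    (ha : a ∈ strip t) (hb : b ∈ strip t) : ((s : ℂ) - a) / (s - b) ∈ Complex.slitPlane := by
  rcases hs with rfl | rfl
  · rw [← neg_div_neg_eq]
    exact div_mem_slitPlane (by simpa using ha.1) (by simpa using hb.1)
  · exact div_mem_slitPlane (by simpa using ha.2) (by simpa using hb.2)

theorem sub_ne_zero_of_mem_strip {t s : ℝ} (hs : s = 0 ∨ s = t) {b : ℂ} (hb : b ∈ strip t) :
    (s : ℂ) - b ≠ 0 := by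
  intro h
  have h' := congrArg Complex.re h
  simp only [Complex.sub_re, Complex.ofReal_re, Complex.zero_re] at h'
  have := hb.1
  have := hb.2
  rcases hs with rfl | rfl <;> linarith

theorem ne_re_of_mem_strip {t s : ℝ} (hs : s = 0 ∨ s = t) {b : ℂ} (hb : b ∈ strip t) :
    s ≠ b.re := by
  rcases hs with rfl | rfl
  · exact hb.1.ne
  · exact hb.2.ne'

theorem sub_div_sub_mem_cutPlane {t s : ℝ} (hs : s = 0 ∨ s = t) {a b : ℂ}
    (ha : a ∈ strip t) (hb : b ∈ strip t) : (a - b) / (s - b) ∈ cutPlane := by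
  rw [mem_cutPlane_iff, sub_div_sub_eq (sub_ne_zero_of_mem_strip hs hb), sub_sub_cancel]
  exact div_mem_slitPlane_of_mem_strip hs ha hb

theorem analyticOnNhd_Phi {β₁ β₂ t s : ℝ} (hs : s = 0 ∨ s = t)
    (hσ : ∀ n : ℕ, β₁ + β₂ + 1 ≠ n) {b : ℂ} (hb : b ∈ strip t) :
    AnalyticOnNhd ℂ (fun a => Phi β₁ β₂ s a b) (strip t) := by
  intro a ha
  simp only [Phi_eq s _ b rfl]
  refine analyticAt_const.mul (AnalyticAt.fun_comp
    (analyticAt_gaussHyp (ne_neg_natCast_of_add_ne hσ) β₁ (sub_div_sub_mem_cutPlane hs ha hb)) ?_)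
  exact (analyticAt_id.sub analyticAt_const).div analyticAt_const (sub_ne_zero_of_mem_strip hs hb)

theorem continuousAt_Phi {β₁ β₂ t s : ℝ} (hs : s = 0 ∨ s = t)
    (hσ : ∀ n : ℕ, β₁ + β₂ + 1 ≠ n) {a b : ℂ} (ha : a ∈ strip t) (hb : b ∈ strip t) :
    ContinuousAt (fun b => Phi β₁ β₂ s a b) b := by
  simp only [Phi_eq s a _ rfl]
  refine ContinuousAt.mul (ContinuousAt.cpow (by fun_prop) continuousAt_const
    (neg_I_mul_sub_mem_slitPlane (ne_re_of_mem_strip hs hb))) ?_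
  refine ContinuousAt.comp' (analyticAt_gaussHyp (ne_neg_natCast_of_add_ne hσ) β₁
    (sub_div_sub_mem_cutPlane hs ha hb)).continuousAt ?_
  exact ContinuousAt.div (by fun_prop) (by fun_prop) (sub_ne_zero_of_mem_strip hs hb)

/-- When `b` is real the integrand is singular inside `(0, t)`; this case is the
limit of the case of `b` in the lower half plane. -/
theorem integralMinus_eq {β₁ β₂ t : ℝ} (hβ₂ : -1 < β₂) (ht : 0 < t)
    (hσ : ∀ n : ℕ, β₁ + β₂ + 1 ≠ n) {a b : ℂ} (ha : a ∈ strip t) (hb : b ∈ strip t)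
    (hai : a.im < 0) (hbi : b.im ≤ 0) :
    integralMinus β₁ β₂ t a b =
      Complex.I / ((β₁ : ℂ) + β₂ + 1) * (Phi β₁ β₂ t a b - Phi β₁ β₂ 0 a b) := by
  have hpath : Filter.Tendsto (fun ε : ℝ => b - ε * Complex.I) (nhdsWithin 0 (Set.Ioi 0))
      (nhds b) := by
    refine Filter.Tendsto.mono_left ?_ (nhdsWithin_le_nhds (s := Set.Ioi 0))
    have : Continuous fun ε : ℝ => b - ε * Complex.I := by fun_prop
    simpa using this.tendsto 0
  have hlim := (((continuousAt_Phi (Or.inr rfl) hσ ha hb).tendsto.comp hpath).sub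
    ((continuousAt_Phi (Or.inl rfl) hσ ha hb).tendsto.comp hpath)).const_mul
      (Complex.I / ((β₁ : ℂ) + β₂ + 1))
  refine tendsto_nhds_unique (tendsto_integralMinus hβ₂ ht hai b) (hlim.congr' ?_)
  filter_upwards [self_mem_nhdsWithin] with ε hε
  rw [integralMinus_eq_of_im_neg hβ₂ ht hσ hai]
  · rfl
  · have : 0 < ε := hε
    simp
    linarith

/-! ### Expansions of `Φ` -/

theorem Phi_eq_of_norm_lt_one {β₁ β₂ s : ℝ} (hσ : ∀ n : ℕ, β₁ + β₂ + 1 ≠ n)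
    (hβ₁ : ∀ n : ℕ, β₁ ≠ -((n : ℝ) + 1)) {a b w : ℂ} (hw : w ∈ Complex.slitPlane)
    (hz : (a - b) / (s - b) = 1 - w) (hw1 : ‖w‖ < 1) :
    Phi β₁ β₂ s a b = (-Complex.I * (s - b)) ^ ((β₁ : ℂ) + β₂ + 1) *
      (Complex.Gamma (-β₁ - β₂) * Complex.Gamma (1 + β₁) / Complex.Gamma (-β₂) *
          (1 - w) ^ ((β₁ : ℂ) + β₂ + 1) +
        ((β₁ : ℂ) + β₂ + 1) / (β₁ + 1) * w ^ (1 + (β₁ : ℂ)) *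
          gaussHyp (-β₂) 1 (β₁ + 2) w) := by
  have hβ : ∀ n : ℕ, (β₁ : ℂ) + 1 ≠ -n := fun n h => hβ₁ n (by
    have h' : β₁ + 1 = -(n : ℝ) := by exact_mod_cast h
    linarith)
  rw [Phi_eq s a b rfl, hz, gaussHyp_eq_of_norm_lt_one (ne_neg_natCast_of_add_ne hσ) hβ hw hw1,
    neg_neg, show -((β₁ : ℂ) + β₂ + 1) + 1 = -β₁ - β₂ by ring,
    show -((β₁ : ℂ) + β₂ + 1) + β₁ + 1 = -β₂ by ring]

theorem Phi_eq_of_one_lt_norm {β₁ β₂ s : ℝ} (hσ : ∀ n : ℕ, β₁ + β₂ + 1 ≠ n) (hβ₂ : -1 < β₂)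
    {a b w : ℂ} (hw : w ∈ Complex.slitPlane) (hz : (a - b) / (s - b) = 1 - w) (hw1 : 1 < ‖w‖) :
    Phi β₁ β₂ s a b = (-Complex.I * (s - b)) ^ ((β₁ : ℂ) + β₂ + 1) *
      (Complex.Gamma (-β₁ - β₂) * Complex.Gamma (1 + β₂) / Complex.Gamma (-β₁) *
          w⁻¹ ^ (-(β₁ : ℂ) - β₂ - 1) * (1 - w⁻¹) ^ ((β₁ : ℂ) + β₂ + 1) +
        ((β₁ : ℂ) + β₂ + 1) / (β₂ + 1) * w⁻¹ ^ (-(β₁ : ℂ)) *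
          gaussHyp (-β₁) 1 (β₂ + 2) w⁻¹) := by
  have hβ : ∀ n : ℕ, (β₂ : ℂ) + 1 ≠ -n := ne_neg_natCast_of_re_pos (by simp; linarith)
  rw [Phi_eq s a b rfl, hz, gaussHyp_eq_of_one_lt_norm (γ := β₂) (ne_neg_natCast_of_add_ne hσ) hβ
    (by ring) hw hw1, neg_neg, show -((β₁ : ℂ) + β₂ + 1) + 1 = -β₁ - β₂ by ring,
    show -((β₁ : ℂ) + β₂ + 1) = -(β₁ : ℂ) - β₂ - 1 by ring]

theorem mainTheorem10 (β₁ β₂ t : ℝ) (hβ₂ : -1 < β₂) (ht : 0 < t) :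
    -- for every `b` with `Im b ≤ 0` the integral converges and is analytic in `a` on `Im a < 0`
    (∀ b : ℂ, b.im ≤ 0 →
      (∀ a : ℂ, a.im < 0 →
        IntervalIntegrable (integrandMinus β₁ β₂ a b) MeasureTheory.volume 0 t) ∧
      AnalyticOnNhd ℂ (fun a => integralMinus β₁ β₂ t a b) {a : ℂ | a.im < 0}) ∧
    -- the hypergeometric function occurring in `Φ` and the prefactor are well defined
    ((∀ n : ℕ, β₁ + β₂ + 1 ≠ n) → ∀ b ∈ strip t, b.im ≤ 0 →
      -- (i) closed formula
      (∀ a ∈ strip t, a.im < b.im →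
        integralMinus β₁ β₂ t a b =
          Complex.I / ((β₁ : ℂ) + β₂ + 1) * (Phi β₁ β₂ t a b - Phi β₁ β₂ 0 a b)) ∧
      -- (i) both functions `Φ` are analytic in `a` on the whole strip
      AnalyticOnNhd ℂ (fun a => Phi β₁ β₂ 0 a b) (strip t) ∧
      AnalyticOnNhd ℂ (fun a => Phi β₁ β₂ t a b) (strip t) ∧
      -- hence the integral extends analytically to the strip, in particular across `a = b`
      (∃ J : ℂ → ℂ, AnalyticOnNhd ℂ J (strip t) ∧
        ∀ a ∈ strip t, a.im < 0 → J a = integralMinus β₁ β₂ t a b) ∧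
      -- (ii)
      ((∀ n : ℕ, β₁ ≠ -((n : ℝ) + 1)) → ∀ a ∈ strip t, ‖a / b‖ < 1 →
        Phi β₁ β₂ 0 a b = (Complex.I * b) ^ ((β₁ : ℂ) + β₂ + 1) *
          (Complex.Gamma (-β₁ - β₂) * Complex.Gamma (1 + β₁) / Complex.Gamma (-β₂) *
              (1 - a / b) ^ ((β₁ : ℂ) + β₂ + 1) +
            ((β₁ : ℂ) + β₂ + 1) / (β₁ + 1) * (a / b) ^ (1 + (β₁ : ℂ)) *
              gaussHyp (-β₂) 1 (β₁ + 2) (a / b))) ∧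
      -- (iii)
      (∀ a ∈ strip t, 1 < ‖a / b‖ →
        Phi β₁ β₂ 0 a b = (Complex.I * b) ^ ((β₁ : ℂ) + β₂ + 1) *
          (Complex.Gamma (-β₁ - β₂) * Complex.Gamma (1 + β₂) / Complex.Gamma (-β₁) *
              (b / a) ^ (-(β₁ : ℂ) - β₂ - 1) * (1 - b / a) ^ ((β₁ : ℂ) + β₂ + 1) +
            ((β₁ : ℂ) + β₂ + 1) / (β₂ + 1) * (b / a) ^ (-(β₁ : ℂ)) *
              gaussHyp (-β₁) 1 (β₂ + 2) (b / a))) ∧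
      -- (iv)
      ((∀ n : ℕ, β₁ ≠ -((n : ℝ) + 1)) → ∀ a ∈ strip t, ‖(t - a) / (t - b)‖ < 1 →
        Phi β₁ β₂ t a b = (-Complex.I * (t - b)) ^ ((β₁ : ℂ) + β₂ + 1) *
          (Complex.Gamma (-β₁ - β₂) * Complex.Gamma (1 + β₁) / Complex.Gamma (-β₂) *
              ((a - b) / (t - b)) ^ ((β₁ : ℂ) + β₂ + 1) +
            ((β₁ : ℂ) + β₂ + 1) / (β₁ + 1) * ((t - a) / (t - b)) ^ (1 + (β₁ : ℂ)) *
              gaussHyp (-β₂) 1 (β₁ + 2) ((t - a) / (t - b)))) ∧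
      -- (v)
      (∀ a ∈ strip t, 1 < ‖(t - a) / (t - b)‖ →
        Phi β₁ β₂ t a b = (-Complex.I * (t - b)) ^ ((β₁ : ℂ) + β₂ + 1) *
          (Complex.Gamma (-β₁ - β₂) * Complex.Gamma (1 + β₂) / Complex.Gamma (-β₁) *
              ((t - b) / (t - a)) ^ (-(β₁ : ℂ) - β₂ - 1) *
              ((b - a) / (t - a)) ^ ((β₁ : ℂ) + β₂ + 1) +
            ((β₁ : ℂ) + β₂ + 1) / (β₂ + 1) * ((t - b) / (t - a)) ^ (-(β₁ : ℂ)) *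
              gaussHyp (-β₁) 1 (β₂ + 2) ((t - b) / (t - a))))) := by
  have hopen : IsOpen {a : ℂ | a.im < 0} := isOpen_lt Complex.continuous_im continuous_const
  refine ⟨fun b _ => ⟨fun a ha => ?_, ?_⟩, fun hσ b hb hbi => ?_⟩
  · exact (intervalIntegrable_integrandMinus_and_differentiableAt hβ₂ ht ha b).1
  · refine DifferentiableOn.analyticOnNhd (fun a ha => ?_) hopen
    exact (intervalIntegrable_integrandMinus_and_differentiableAt hβ₂ ht ha
      b).2.differentiableWithinAt
  have hΦ0 := analyticOnNhd_Phi (β₁ := β₁) (β₂ := β₂) (t := t) (Or.inl rfl) hσ hb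
  have hΦt := analyticOnNhd_Phi (β₁ := β₁) (β₂ := β₂) (t := t) (Or.inr rfl) hσ hb
  have hb0 : b ≠ 0 := by
    rintro rfl
    exact lt_irrefl _ hb.1
  have htb : (t : ℂ) - b ≠ 0 := sub_ne_zero_of_mem_strip (Or.inr rfl) hb
  have hz0 : ∀ a : ℂ, (a - b) / (((0 : ℝ) : ℂ) - b) = 1 - a / b := fun a => by
    rw [Complex.ofReal_zero]
    field_simp
    ring
  have hpre : -Complex.I * (((0 : ℝ) : ℂ) - b) = Complex.I * b := by simp
  have hw0 : ∀ a ∈ strip t, a / b ∈ Complex.slitPlane := fun a ha => div_mem_slitPlane ha.1 hb.1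
  have hwt : ∀ a ∈ strip t, ((t : ℂ) - a) / (t - b) ∈ Complex.slitPlane := fun a ha =>
    div_mem_slitPlane_of_mem_strip (Or.inr rfl) ha hb
  refine ⟨fun a ha hab => integralMinus_eq hβ₂ ht hσ ha hb (hab.trans_le hbi) hbi, hΦ0, hΦt,
    ⟨_, analyticOnNhd_const.mul (hΦt.sub hΦ0), fun a ha hai =>
      (integralMinus_eq hβ₂ ht hσ ha hb hai hbi).symm⟩, ?_, ?_, ?_, ?_⟩
  · intro hβ₁ a ha h1
    rw [Phi_eq_of_norm_lt_one hσ hβ₁ (hw0 a ha) (hz0 a) h1, hpre]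
  · intro a ha h1
    rw [Phi_eq_of_one_lt_norm hσ hβ₂ (hw0 a ha) (hz0 a) h1, hpre, inv_div]
  · intro hβ₁ a ha h1
    rw [Phi_eq_of_norm_lt_one hσ hβ₁ (hwt a ha) (sub_div_sub_eq htb) h1, ← sub_div_sub_eq htb]
  · intro a ha h1
    have hta : (t : ℂ) - a ≠ 0 := sub_ne_zero_of_mem_strip (Or.inr rfl) ha
    rw [Phi_eq_of_one_lt_norm hσ hβ₂ (hwt a ha) (sub_div_sub_eq htb) h1, inv_div,
      ← sub_div_sub_eq hta]
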